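/- Let $\mathcal{D} = ([0,1/2]\times[0,1/3]) \cup ([0,1/3]\times[0,1/2])$, and for $k \ge 1$ let $$\mathcal{D}_k = \{(s_1,\dots,s_k,t_1,\dots,t_k)\in[0,1]^{2k} : (s_1+\cdots+s_k,\; t_1+\cdots+t_k)\in\mathcal{D}\}.$$ For a function $f:[0,1]^{2k}\to\mathbb{R}$ and $1\le \ell,\ell'\le k$ put $$I_k(f)=\int_{[0,1]^{2k}} f(s,t)^2\,ds\,dt,\qquad J_k^{(\ell,\ell')}(f)=\int_{[0,1]^{2k}}\left(\int_0^1\!\!\int_0^1 f(s_1,\dots,s_k,t_1,\dots,t_k)\,ds_\ell\,dt_{\ell'}\right)^2 ds\,dt .$$ Call $f$ piecewise continuous if $[0,1]^{2k}$ can be partitioned into finitely many pieces, each with boundary of Lebesgue measure zero, such that the restriction of $f$ to each piece extends continuously to the closure of that piece. Define $$M^2_k(\mathcal{D})=\sup_f \frac{\sum_{\ell=1}^{k}\sum_{\ell'=1}^{k}J_k^{(\ell,\ell')}(f)}{I_k(f)},$$ where the supremum, taken in the extended real line, is over all piecewise continuous $f:[0,1]^{2k}\to\mathbb{R}$ with $I_k(f)>0$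 that vanish outside some closed set $\mathcal{R}\subseteq[0,1]^{2k}$ satisfying $\mathcal{R}+\mathcal{R}=\{x+y : x,y\in\mathcal{R}\}\subseteq\mathcal{D}_k$ (the set $\mathcal{R}$ may depend on $f$). Then $$M^2_{2000}(\mathcal{D})>1 .$$ -/

import Mathlib

open MeasureTheory Set
open scoped Pointwise

/-- The planar region `𝒟 = ([0,1/2] × [0,1/3]) ∪ ([0,1/3] × [0,1/2])`. -/
def regionD : Set (ℝ × ℝ) :=
  (Icc (0 : ℝ) (1 / 2) ×ˢ Icc (0 : ℝ) (1 / 3)) ∪ (Icc (0 : ℝ) (1 / 3) ×ˢ Icc (0 : ℝ) (1 / 2))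

/-- Points `(s, t) = (s₁,…,s_k,t₁,…,t_k)` of `ℝ^{2k} = ℝ^k × ℝ^k`. -/
abbrev Pt (k : ℕ) : Type := (Fin k → ℝ) × (Fin k → ℝ)

/-- The unit cube `[0,1]^{2k}`. -/
def cube (k : ℕ) : Set (Pt k) :=
  {x | (∀ i, x.1 i ∈ Icc (0 : ℝ) 1) ∧ (∀ i, x.2 i ∈ Icc (0 : ℝ) 1)}

/-- `D_k = {(s, t) ∈ [0,1]^{2k} : (s₁+⋯+s_k, t₁+⋯+t_k) ∈ D}`. -/
def liftRegion (k : ℕ) (D : Set (ℝ × ℝ)) : Set (Pt k) :=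
  {x | x ∈ cube k ∧ (∑ i, x.1 i, ∑ i, x.2 i) ∈ D}

/-- `f` is piecewise continuous on the cube: the cube is partitioned into finitely many pieces with
Lebesgue-null boundary (Jordan measurable pieces), and on each piece `f` agrees with a function
that is continuous on the closure of the piece. -/
def IsPiecewiseContinuous (k : ℕ) (f : Pt k → ℝ) : Prop :=
  ∃ (n : ℕ) (P : Fin n → Set (Pt k)),
    (⋃ i, P i) = cube k ∧
    (∀ i j, i ≠ j → Disjoint (P i) (P j)) ∧
    (∀ i, volume (frontier (P i)) = 0) ∧
    ∀ i, ∃ g : Pt k → ℝ, ContinuousOn g (closure (P i)) ∧ EqOn f g (P i)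

/-- The functions over which the supremum is taken. A function on `[0,1]^{2k}` is represented by its
extension by zero to `ℝ^{2k}`; this is part of the requirement that `f` vanishes off `R`. -/
def IsAdmissible (k : ℕ) (D : Set (ℝ × ℝ)) (f : Pt k → ℝ) : Prop :=
  IsPiecewiseContinuous k f ∧
  ∃ R : Set (Pt k), IsClosed R ∧ R ⊆ cube k ∧ R + R ⊆ liftRegion k D ∧
    ∀ x, f x ≠ 0 → x ∈ R

/-- `I_k(f) = ∫_{[0,1]^{2k}} f²`. -/
noncomputable def IInt (k : ℕ) (f : Pt k → ℝ) : ℝ :=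
  ∫ x in cube k, f x ^ 2

/-- `J_k^{(ℓ,ℓ')}(f) = ∫_{[0,1]^{2k}} (∫₀¹ ∫₀¹ f(s, t) ds_ℓ dt_ℓ')² ds dt`. -/
noncomputable def JInt (k : ℕ) (l l' : Fin k) (f : Pt k → ℝ) : ℝ :=
  ∫ x in cube k,
    (∫ v in (0 : ℝ)..1, ∫ u in (0 : ℝ)..1,
      f (Function.update x.1 l u, Function.update x.2 l' v)) ^ 2

/-- `M²_k(D)`, the supremum (in the extended reals) of `(∑_ℓ ∑_ℓ' J_k^{(ℓ,ℓ')}(f)) / I_k(f)` over all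
admissible `f` for which the quotient makes sense. -/
noncomputable def MSq (k : ℕ) (D : Set (ℝ × ℝ)) : EReal :=
  sSup {r : EReal | ∃ f : Pt k → ℝ, IsAdmissible k D f ∧ 0 < IInt k f ∧
    r = (((∑ l : Fin k, ∑ l' : Fin k, JInt k l l' f) / IInt k f : ℝ) : EReal)}

/-!
Take `f (s, t) = F s * G t` with `F` supported on the simplex `∑ sᵢ ≤ 1/4` and `G` on
`∑ tᵢ ≤ 1/6`: sums of two points of the support then have coordinate sums in
`[0, 1/2] × [0, 1/3] ⊆ 𝒟`, and the quotient factors into the Maynard–Tao quotients of `F` and `G`.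
Rescaling from the unit simplex to the simplex of size `a` multiplies such a quotient by `a`, so one
needs a quotient larger than `√24 ≈ 4.899` on the unit simplex.

On `∑ xᵢ ≤ r`, let `F` be the product of the `g (xᵢ)`, where `g` lives on `[0, 1]`. Each marginal
of `F` equals `∫ g` times the product of the remaining factors as soon as their variables have sum
at most `r - 1`, so the quotient is bounded below by `k (∫ g)²` times a ratio of integrals of
`∏ g²` over two simplices. Rather than estimating that ratio for one `r` by concentration of
measure, average over `r` against `exp (-c r)`: the averages are products of integrals over one
variable, and some `r` does at least as well as the averages. With
`g t = 1 / (1 + c k t)` this gives every value below `log (1 + c k) * exp (-c)`, about `4.92` for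
`k = 2000` and `c = 0.17`.
-/

open Filter Topology

section SizeAveraging

theorem hasDerivAt_neg_add_mul_exp_neg_mul {c : ℝ} (hc : c ≠ 0) (x : ℝ) :
    HasDerivAt (fun r => -((r + c⁻¹) * Real.exp (-c * r) / c)) (x * Real.exp (-c * x)) x := by
  have hexp : HasDerivAt (fun r => Real.exp (-c * r)) (Real.exp (-c * x) * (-c * 1)) x :=
    ((hasDerivAt_id x).const_mul (-c)).exp
  refine ((((hasDerivAt_id x).add_const c⁻¹).mul hexp).div_const c).neg.congr_deriv ?_
  simp only [id_eq]
  field_simp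
  ring

theorem tendsto_neg_add_mul_exp_neg_mul_atTop {c : ℝ} (hc : 0 < c) :
    Tendsto (fun r => -((r + c⁻¹) * Real.exp (-c * r) / c)) atTop (𝓝 0) := by
  have hlin := tendsto_rpow_mul_exp_neg_mul_atTop_nhds_zero 1 c hc
  have hconst := tendsto_rpow_mul_exp_neg_mul_atTop_nhds_zero 0 c hc
  simp only [Real.rpow_one, Real.rpow_zero, one_mul] at hlin hconst
  simpa [add_mul] using ((hlin.add (hconst.const_mul c⁻¹)).div_const c).neg

theorem integrableOn_mul_exp_neg_mul_Ioi_zero {c : ℝ} (hc : 0 < c) :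
    IntegrableOn (fun r => r * Real.exp (-c * r)) (Ioi 0) :=
  integrableOn_Ioi_deriv_of_nonneg'
    (fun x _ => hasDerivAt_neg_add_mul_exp_neg_mul hc.ne' x)
    (fun _ hx => mul_nonneg (le_of_lt hx) (Real.exp_nonneg _))
    (tendsto_neg_add_mul_exp_neg_mul_atTop hc)

theorem integral_mul_exp_neg_mul_Ioi {c s : ℝ} (hc : 0 < c) (hs : 0 ≤ s) :
    ∫ r in Ioi s, r * Real.exp (-c * r) = (s + c⁻¹) * Real.exp (-c * s) / c := by
  rw [integral_Ioi_of_hasDerivAt_of_nonneg'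
    (fun x _ => hasDerivAt_neg_add_mul_exp_neg_mul hc.ne' x)
    (fun _ hx => mul_nonneg (hs.trans (le_of_lt hx)) (Real.exp_nonneg _))
    (tendsto_neg_add_mul_exp_neg_mul_atTop hc), zero_sub, neg_neg]

variable {α : Type*} [MeasurableSpace α] {ν : Measure α} {S W : α → ℝ} {h : ℝ → ℝ}

theorem integrable_mul_indicator_le (hS : Measurable S) (hW : Integrable W ν)
    (hh : IntegrableOn h (Ioi 0)) :
    Integrable (fun p : ℝ × α => h p.1 * {x | S x ≤ p.1}.indicator W p.2)
      ((volume.restrict (Ioi 0)).prod ν) := by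
  refine ((hh.mul_prod hW).indicator
    (measurableSet_le (hS.comp measurable_snd) measurable_fst)).congr (.of_forall fun p => ?_)
  by_cases hp : S p.2 ≤ p.1 <;> simp [hp]

variable [SFinite ν]

theorem integrableOn_mul_integral_indicator_le (hS : Measurable S) (hW : Integrable W ν)
    (hh : IntegrableOn h (Ioi 0)) :
    IntegrableOn (fun r => h r * ∫ x, {x | S x ≤ r}.indicator W x ∂ν) (Ioi 0) := by
  simp_rw [← integral_const_mul]
  exact (integrable_mul_indicator_le hS hW hh).integral_prod_left

theorem integral_mul_integral_indicator_le (hS : Measurable S) (hW : Integrable W ν)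
    (hh : IntegrableOn h (Ioi 0)) (hSW : ∀ x, W x ≠ 0 → 0 ≤ S x) :
    ∫ r in Ioi 0, h r * ∫ x, {x | S x ≤ r}.indicator W x ∂ν =
      ∫ x, W x * (∫ r in Ioi (S x), h r) ∂ν := by
  simp_rw [← integral_const_mul]
  rw [integral_integral_swap (integrable_mul_indicator_le hS hW hh)]
  refine integral_congr_ae (.of_forall fun x => ?_)
  dsimp only
  by_cases hx : W x = 0
  · simp [indicator, hx]
  have hset : ∀ r, h r * {x | S x ≤ r}.indicator W x = (Ici (S x)).indicator (W x * h ·) r := by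
    intro r
    by_cases hr : S x ≤ r <;> simp [hr, mul_comm]
  simp_rw [hset]
  rw [setIntegral_indicator measurableSet_Ici]
  rw [setIntegral_congr_set ((ae_eq_refl (Ioi 0)).inter Ioi_ae_eq_Ici.symm), Ioi_inter_Ioi,
    max_eq_right (hSW x hx), integral_const_mul]

end SizeAveraging

/-- Nonnegative functions supported on `[0, 1]` and continuous there. Tensor powers of such
profiles, restricted to a half-space `∑ i, x i ≤ r`, serve as test functions on a simplex. -/
structure IsProfile (g : ℝ → ℝ) : Prop where
  nonneg : ∀ x, 0 ≤ g x
  continuousOn : ContinuousOn g (Icc 0 1)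
  eq_zero : ∀ x ∉ Icc 0 1, g x = 0

namespace IsProfile

variable {g g' φ : ℝ → ℝ}

theorem integrable (hg : IsProfile g) : Integrable g :=
  (integrableOn_iff_integrable_of_support_subset
    (Function.support_subset_iff'.2 hg.eq_zero)).1 hg.continuousOn.integrableOn_Icc

theorem integral_eq_intervalIntegral (hg : IsProfile g) : ∫ x, g x = ∫ x in (0 : ℝ)..1, g x := by
  rw [intervalIntegral.integral_of_le zero_le_one, ← integral_Icc_eq_integral_Ioc,
    setIntegral_eq_integral_of_forall_compl_eq_zero hg.eq_zero]

theorem integral_pos (hg : IsProfile g) (hpos : ∀ x ∈ Ioo (0 : ℝ) 1, 0 < g x) : 0 < ∫ x, g x := by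
  rw [hg.integral_eq_intervalIntegral]
  exact intervalIntegral.intervalIntegral_pos_of_pos_on hg.integrable.intervalIntegrable hpos
    zero_lt_one

theorem continuous_mul (hφ : Continuous φ) (hφ0 : ∀ x ∈ Icc (0 : ℝ) 1, 0 ≤ φ x)
    (hg : IsProfile g) : IsProfile fun x => φ x * g x where
  nonneg x := by
    by_cases hx : x ∈ Icc (0 : ℝ) 1
    · exact mul_nonneg (hφ0 x hx) (hg.nonneg x)
    · rw [hg.eq_zero x hx, mul_zero]
  continuousOn := hφ.continuousOn.mul hg.continuousOn
  eq_zero x hx := by rw [hg.eq_zero x hx, mul_zero]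

theorem exp_neg_mul (c : ℝ) (hg : IsProfile g) : IsProfile fun x => Real.exp (-c * x) * g x :=
  hg.continuous_mul (by fun_prop) fun _ _ => Real.exp_nonneg _

theorem sq (hg : IsProfile g) : IsProfile fun x => g x ^ 2 where
  nonneg x := sq_nonneg _
  continuousOn := hg.continuousOn.pow 2
  eq_zero x hx := by rw [hg.eq_zero x hx, zero_pow two_ne_zero]

end IsProfile

/-- The tensor power `∏ i, g (x i)` restricted to the half-space `∑ i, x i ≤ r`. -/
noncomputable def cutoffProd {ι : Type*} [Fintype ι] (g : ℝ → ℝ) (r : ℝ) : (ι → ℝ) → ℝ :=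
  {x | ∑ i, x i ≤ r}.indicator fun x => ∏ i, g (x i)

section CutoffProd

variable {ι : Type*} [Fintype ι] {g w : ℝ → ℝ} {r : ℝ} {x : ι → ℝ}

theorem cutoffProd_of_sum_le (hx : ∑ i, x i ≤ r) : cutoffProd g r x = ∏ i, g (x i) :=
  indicator_of_mem (s := {x : ι → ℝ | ∑ i, x i ≤ r}) hx _

theorem cutoffProd_of_lt_sum (hx : r < ∑ i, x i) : cutoffProd g r x = 0 :=
  indicator_of_notMem (s := {x : ι → ℝ | ∑ i, x i ≤ r}) hx.not_ge _

theorem cutoffProd_sq : cutoffProd g r x ^ 2 = cutoffProd (fun t => g t ^ 2) r x := by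
  rcases le_or_gt (∑ i, x i) r with hx | hx
  · rw [cutoffProd_of_sum_le hx, cutoffProd_of_sum_le hx, Finset.prod_pow]
  · rw [cutoffProd_of_lt_sum hx, cutoffProd_of_lt_sum hx, zero_pow two_ne_zero]

theorem cutoffProd_nonneg (hg : ∀ t, 0 ≤ g t) : 0 ≤ cutoffProd g r x :=
  indicator_nonneg (fun _ _ => Finset.prod_nonneg fun _ _ => hg _) x

theorem cutoffProd_le_prod (hg : ∀ t, 0 ≤ g t) : cutoffProd g r x ≤ ∏ i, g (x i) :=
  indicator_le_self' (fun _ _ => Finset.prod_nonneg fun _ _ => hg _) x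

namespace IsProfile

theorem integrable_prod (hg : IsProfile g) : Integrable fun x : ι → ℝ => ∏ i, g (x i) :=
  Integrable.fintype_prod fun _ => hg.integrable

theorem integrable_cutoffProd (hg : IsProfile g) (r : ℝ) :
    Integrable (cutoffProd g r : (ι → ℝ) → ℝ) :=
  hg.integrable_prod.indicator (measurableSet_le (by fun_prop) measurable_const)

theorem mem_Icc_of_prod_ne_zero (hg : IsProfile g) (hx : ∏ i, g (x i) ≠ 0) :
    x ∈ Icc (0 : ι → ℝ) 1 := by
  have hmem : ∀ i, x i ∈ Icc (0 : ℝ) 1 := fun i =>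
    by_contra fun h => hx (Finset.prod_eq_zero (Finset.mem_univ i) (hg.eq_zero _ h))
  exact ⟨fun i => (hmem i).1, fun i => (hmem i).2⟩

theorem sum_nonneg_of_prod_ne_zero (hg : IsProfile g) (hx : ∏ i, g (x i) ≠ 0) :
    0 ≤ ∑ i, x i :=
  Finset.sum_nonneg fun i _ => (hg.mem_Icc_of_prod_ne_zero hx).1 i

end IsProfile

theorem prod_mul_exp_neg_mul_sum (w : ℝ → ℝ) (c : ℝ) (x : ι → ℝ) :
    (∏ i, w (x i)) * Real.exp (-c * ∑ i, x i) = ∏ i, Real.exp (-c * x i) * w (x i) := by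
  rw [Finset.mul_sum, Real.exp_sum, Finset.prod_mul_distrib, mul_comm]

theorem mul_prod_eq_prod_update [DecidableEq ι] (φ v : ℝ → ℝ) (i : ι) (x : ι → ℝ) :
    φ (x i) * ∏ j, v (x j) =
      ∏ j, Function.update (fun _ => v) i (fun t => φ t * v t) j (x j) := by
  rw [← Finset.mul_prod_erase _ _ (Finset.mem_univ i),
    ← Finset.mul_prod_erase _ _ (Finset.mem_univ i), Function.update_self, mul_assoc]
  congr 2
  refine Finset.prod_congr rfl fun j hj => ?_
  rw [Function.update_of_ne (Finset.ne_of_mem_erase hj)]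

theorem integrable_mul_prod {φ v : ℝ → ℝ} (hv : Integrable v)
    (hφv : Integrable fun t => φ t * v t) (i : ι) :
    Integrable fun x : ι → ℝ => φ (x i) * ∏ j, v (x j) := by
  classical
  simp_rw [mul_prod_eq_prod_update]
  refine Integrable.fintype_prod_dep (μ := fun _ => volume) fun j => ?_
  rcases eq_or_ne j i with rfl | hj
  · rwa [Function.update_self]
  · rwa [Function.update_of_ne hj]

theorem integral_mul_prod (φ v : ℝ → ℝ) (i : ι) :
    ∫ x : ι → ℝ, φ (x i) * ∏ j, v (x j) =
      (∫ t, φ t * v t) * (∫ t, v t) ^ (Fintype.card ι - 1) := by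
  classical
  simp_rw [mul_prod_eq_prod_update]
  rw [integral_fintype_prod_volume_eq_prod, ← Finset.mul_prod_erase _ _ (Finset.mem_univ i),
    Function.update_self,
    Finset.prod_congr rfl fun j hj => by rw [Function.update_of_ne (Finset.ne_of_mem_erase hj)],
    Finset.prod_const, Finset.card_erase_of_mem (Finset.mem_univ i), Finset.card_univ]

theorem integral_sum_mul_prod {φ v : ℝ → ℝ} (hv : Integrable v)
    (hφv : Integrable fun t => φ t * v t) :
    ∫ x : ι → ℝ, (∑ i, φ (x i)) * ∏ i, v (x i) =
      Fintype.card ι * ((∫ t, φ t * v t) * (∫ t, v t) ^ (Fintype.card ι - 1)) := by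
  simp_rw [Finset.sum_mul]
  rw [integral_finsetSum _ fun i _ => integrable_mul_prod hv hφv i]
  simp_rw [integral_mul_prod]
  rw [Finset.sum_const, Finset.card_univ, nsmul_eq_mul]

theorem integral_exp_neg_mul_integral_cutoffProd {c : ℝ} (hc : 0 < c) (hw : IsProfile w) :
    ∫ r in Ioi 0, Real.exp (-c * r) * ∫ x : ι → ℝ, cutoffProd w (r - 1) x =
      Real.exp (-c) / c * (∫ t, Real.exp (-c * t) * w t) ^ Fintype.card ι := by
  have hlaplace := integral_mul_integral_indicator_le (S := fun x : ι → ℝ => ∑ i, x i + 1)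
    (by fun_prop) hw.integrable_prod (integrableOn_exp_mul_Ioi (neg_neg_of_pos hc) 0)
    fun x hx => add_nonneg (hw.sum_nonneg_of_prod_ne_zero hx) zero_le_one
  simp_rw [← le_sub_iff_add_le] at hlaplace
  have htail : ∀ x : ι → ℝ, (∏ i, w (x i)) * ∫ r in Ioi (∑ i, x i + 1), Real.exp (-c * r) =
      Real.exp (-c) / c * ∏ i, Real.exp (-c * x i) * w (x i) := by
    intro x
    rw [integral_exp_mul_Ioi (neg_neg_of_pos hc), ← prod_mul_exp_neg_mul_sum, mul_add, Real.exp_add]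
    field_simp
  simp_rw [htail] at hlaplace
  rwa [integral_const_mul, integral_fintype_prod_volume_eq_pow (fun t => Real.exp (-c * t) * w t)]
    at hlaplace

theorem integral_mul_exp_neg_mul_integral_cutoffProd [Nonempty ι] {c : ℝ} (hc : 0 < c)
    (hw : IsProfile w) :
    ∫ r in Ioi 0, r * Real.exp (-c * r) * ∫ x : ι → ℝ, cutoffProd w r x =
      Fintype.card ι / c * ((∫ t, (t + (c * Fintype.card ι)⁻¹) * (Real.exp (-c * t) * w t)) *
        (∫ t, Real.exp (-c * t) * w t) ^ (Fintype.card ι - 1)) := by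
  have hcard : (Fintype.card ι : ℝ) ≠ 0 := Nat.cast_ne_zero.2 Fintype.card_ne_zero
  have htail : ∀ x : ι → ℝ,
      (∏ i, w (x i)) * ∫ r in Ioi (∑ i, x i), r * Real.exp (-c * r) =
        c⁻¹ * ((∑ i, (x i + (c * Fintype.card ι)⁻¹)) * ∏ i, Real.exp (-c * x i) * w (x i)) := by
    intro x
    by_cases hx : ∏ i, w (x i) = 0
    · rw [← prod_mul_exp_neg_mul_sum, hx, zero_mul, zero_mul, mul_zero, mul_zero]
    rw [integral_mul_exp_neg_mul_Ioi hc (hw.sum_nonneg_of_prod_ne_zero hx),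
      ← prod_mul_exp_neg_mul_sum, Finset.sum_add_distrib, Finset.sum_const, Finset.card_univ,
      nsmul_eq_mul]
    field_simp
  have hlaplace := integral_mul_integral_indicator_le (S := fun x : ι → ℝ => ∑ i, x i)
    (by fun_prop) hw.integrable_prod (integrableOn_mul_exp_neg_mul_Ioi_zero hc)
    fun x hx => hw.sum_nonneg_of_prod_ne_zero hx
  simp_rw [htail] at hlaplace
  refine hlaplace.trans ?_
  have hv := hw.exp_neg_mul c
  have hφv : IsProfile fun t => (t + (c * Fintype.card ι)⁻¹) * (Real.exp (-c * t) * w t) :=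
    hv.continuous_mul (by fun_prop) fun t ht => add_nonneg ht.1 (by positivity)
  rw [integral_const_mul, integral_sum_mul_prod (φ := fun t => t + (c * Fintype.card ι)⁻¹)
    (v := fun t => Real.exp (-c * t) * w t) hv.integrable hφv.integrable]
  ring

end CutoffProd

theorem exists_mul_integral_cutoffProd_lt {w : ℝ → ℝ} (hw : IsProfile w) {b c C : ℝ} (hb : 0 ≤ b)
    (hc : 0 < c) (n : ℕ) (hmass : 0 < ∫ t, Real.exp (-c * t) * w t)
    (h : C * ((n + 1) * ∫ t, (t + (c * (n + 1))⁻¹) * (Real.exp (-c * t) * w t)) <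
      b * Real.exp (-c)) :
    ∃ r > 0, C * (r * ∫ x : Fin (n + 1) → ℝ, cutoffProd w r x) <
      b * ∫ x : Fin n → ℝ, cutoffProd w (r - 1) x := by
  -- Were the inequality false for every `r`, it would stay false after integration against
  -- `exp (-c * r)`, where both sides factor over the coordinates.
  by_contra! hle
  have hbound : ∫ r in Ioi 0, b * (Real.exp (-c * r) * ∫ x : Fin n → ℝ, cutoffProd w (r - 1) x) ≤
      ∫ r in Ioi 0, C * (r * Real.exp (-c * r) * ∫ x : Fin (n + 1) → ℝ, cutoffProd w r x) := by
    refine integral_mono_of_nonneg (.of_forall fun r => ?_) (.const_mul ?_ C)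
      ((ae_restrict_iff' measurableSet_Ioi).2 (.of_forall fun r hr => ?_))
    · exact mul_nonneg hb (mul_nonneg (Real.exp_nonneg _)
        (integral_nonneg fun x => cutoffProd_nonneg hw.nonneg))
    · exact integrableOn_mul_integral_indicator_le (by fun_prop) hw.integrable_prod
        (integrableOn_mul_exp_neg_mul_Ioi_zero hc)
    · linear_combination Real.exp (-c * r) * hle r hr
  rw [integral_const_mul, integral_const_mul, integral_exp_neg_mul_integral_cutoffProd hc hw,
    integral_mul_exp_neg_mul_integral_cutoffProd hc hw] at hbound
  simp only [Fintype.card_fin, Nat.cast_add, Nat.cast_one, add_tsub_cancel_right] at hbound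
  refine hbound.not_gt ?_
  have := mul_lt_mul_of_pos_right h (div_pos (pow_pos hmass n) hc)
  convert this using 1 <;> ring

/-- The sum over `l` of the integrals of the squares of the marginals `∫ F dx_l`: the numerator of
the Maynard–Tao quotient of a function of one block of variables. Integrals are taken over the whole
space, since the functions of interest vanish off the unit box. -/
noncomputable def marginalEnergy {n : ℕ} (F : (Fin (n + 1) → ℝ) → ℝ) : ℝ :=
  ∑ l : Fin (n + 1), ∫ y : Fin n → ℝ, (∫ u, F (l.insertNth u y)) ^ 2

section MarginalEnergy

variable {n : ℕ} {F : (Fin (n + 1) → ℝ) → ℝ} {g : ℝ → ℝ} {β : ℝ}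

theorem measurePreserving_insertNth (l : Fin (n + 1)) :
    MeasurePreserving fun p : ℝ × (Fin n → ℝ) => (l.insertNth p.1 p.2 : Fin (n + 1) → ℝ) :=
  (volume_preserving_piFinSuccAbove (fun _ : Fin (n + 1) => ℝ) l).symm

theorem measurableEmbedding_insertNth (l : Fin (n + 1)) :
    MeasurableEmbedding fun p : ℝ × (Fin n → ℝ) => (l.insertNth p.1 p.2 : Fin (n + 1) → ℝ) :=
  (MeasurableEquiv.piFinSuccAbove (fun _ : Fin (n + 1) => ℝ) l).symm.measurableEmbedding

theorem integrable_comp_insertNth (hF : Integrable F) (l : Fin (n + 1)) :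
    Integrable fun p : ℝ × (Fin n → ℝ) => F (l.insertNth p.1 p.2) :=
  (measurePreserving_insertNth l).integrable_comp_of_integrable hF

theorem marginalEnergy_eq_zero_of_ae (hF : F =ᵐ[volume] 0) : marginalEnergy F = 0 := by
  refine Finset.sum_eq_zero fun l _ => integral_eq_zero_of_ae ?_
  have hprod : ∀ᵐ p : (Fin n → ℝ) × ℝ, F (l.insertNth p.2 p.1) = 0 :=
    ((measurePreserving_insertNth l).comp
      Measure.measurePreserving_swap).quasiMeasurePreserving.ae hF
  filter_upwards [Measure.ae_ae_of_ae_prod hprod] with y hy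
  rw [integral_eq_zero_of_ae hy, zero_pow two_ne_zero, Pi.zero_apply]

theorem integral_sq_pos_of_marginalEnergy_pos (hF : Integrable fun x => F x ^ 2)
    (hpos : 0 < marginalEnergy F) : 0 < ∫ x, F x ^ 2 := by
  refine (integral_nonneg fun x => sq_nonneg _).lt_of_ne' fun h => hpos.ne' ?_
  refine marginalEnergy_eq_zero_of_ae ?_
  filter_upwards [(integral_eq_zero_iff_of_nonneg (fun x => sq_nonneg (F x)) hF).1 h] with x hx
  exact pow_eq_zero_iff two_ne_zero |>.1 hx

theorem integral_comp_smul_sq {k : ℕ} (F : (Fin k → ℝ) → ℝ) (hβ : 0 < β) :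
    ∫ x, F (β • x) ^ 2 = (β ^ k)⁻¹ * ∫ x, F x ^ 2 := by
  rw [Measure.integral_comp_smul volume (fun x => F x ^ 2), Module.finrank_fin_fun, smul_eq_mul,
    abs_of_pos (by positivity)]

theorem marginalEnergy_comp_smul (F : (Fin (n + 1) → ℝ) → ℝ) (hβ : 0 < β) :
    marginalEnergy (fun x => F (β • x)) = (β ^ (n + 2))⁻¹ * marginalEnergy F := by
  have hmarginal : ∀ (l : Fin (n + 1)) (y : Fin n → ℝ),
      ∫ u, F (β • l.insertNth u y) = β⁻¹ * ∫ u, F (l.insertNth u (β • y)) := by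
    intro l y
    have hsmul : ∀ u, β • (l.insertNth u y : Fin (n + 1) → ℝ) = l.insertNth (β * u) (β • y) :=
      fun u => by
        refine Fin.eq_insertNth_iff.2 ⟨?_, ?_⟩
        · simp
        · ext; simp [Fin.removeNth]
    simp_rw [hsmul]
    rw [Measure.integral_comp_mul_left (fun u => F (l.insertNth u (β • y))), smul_eq_mul,
      abs_of_pos (inv_pos.2 hβ)]
  simp_rw [marginalEnergy, hmarginal, mul_pow, integral_const_mul, Finset.mul_sum]
  refine Finset.sum_congr rfl fun l _ => ?_
  rw [Measure.integral_comp_smul volume fun y : Fin n → ℝ => (∫ u, F (l.insertNth u y)) ^ 2,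
    Module.finrank_fin_fun, smul_eq_mul, abs_of_pos (by positivity)]
  field_simp
  ring

theorem cutoffProd_insertNth_le (hg : ∀ t, 0 ≤ g t) (r : ℝ) (l : Fin (n + 1)) (u : ℝ)
    (y : Fin n → ℝ) :
    cutoffProd g r (l.insertNth u y : Fin (n + 1) → ℝ) ≤ g u * ∏ i, g (y i) := by
  refine (cutoffProd_le_prod hg).trans_eq ?_
  simp only [Fin.prod_univ_succAbove _ l, Fin.insertNth_apply_same, Fin.insertNth_apply_succAbove]

namespace IsProfile

theorem mul_cutoffProd_le_cutoffProd_insertNth (hg : IsProfile g) (r : ℝ) (l : Fin (n + 1)) (u : ℝ)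
    (y : Fin n → ℝ) :
    g u * cutoffProd g (r - 1) y ≤ cutoffProd g r (l.insertNth u y : Fin (n + 1) → ℝ) := by
  by_cases hu : u ∈ Icc (0 : ℝ) 1
  · rcases le_or_gt (∑ i, y i) (r - 1) with hy | hy
    · rw [cutoffProd_of_sum_le hy, cutoffProd_of_sum_le]
      · simp only [Fin.prod_univ_succAbove _ l, Fin.insertNth_apply_same,
          Fin.insertNth_apply_succAbove, le_refl]
      · simp only [Fin.sum_univ_succAbove _ l, Fin.insertNth_apply_same,
          Fin.insertNth_apply_succAbove]
        linarith [hu.2]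
    · rw [cutoffProd_of_lt_sum hy, mul_zero]
      exact cutoffProd_nonneg hg.nonneg
  · rw [hg.eq_zero u hu, zero_mul]
    exact cutoffProd_nonneg hg.nonneg

theorem marginal_cutoffProd_le (hg : IsProfile g) (r : ℝ) (l : Fin (n + 1)) (y : Fin n → ℝ) :
    ∫ u, cutoffProd g r (l.insertNth u y : Fin (n + 1) → ℝ) ≤ (∫ u, g u) * ∏ i, g (y i) := by
  rw [← integral_mul_const]
  exact integral_mono_of_nonneg (.of_forall fun u => cutoffProd_nonneg hg.nonneg)
    (hg.integrable.mul_const _) (.of_forall fun u => cutoffProd_insertNth_le hg.nonneg r l u y)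

theorem integrable_marginal_cutoffProd_sq (hg : IsProfile g) (r : ℝ) (l : Fin (n + 1)) :
    Integrable fun y : Fin n → ℝ =>
      (∫ u, cutoffProd g r (l.insertNth u y : Fin (n + 1) → ℝ)) ^ 2 := by
  refine (hg.sq.integrable_prod.const_mul ((∫ u, g u) ^ 2)).mono'
    ((integrable_comp_insertNth (hg.integrable_cutoffProd r) l).integral_prod_right
      |>.aestronglyMeasurable.pow 2) (.of_forall fun y => ?_)
  rw [Real.norm_of_nonneg (sq_nonneg _), Finset.prod_pow, ← mul_pow]
  exact pow_le_pow_left₀ (integral_nonneg fun u => cutoffProd_nonneg hg.nonneg)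
    (hg.marginal_cutoffProd_le r l y) 2

theorem ae_mul_cutoffProd_le_marginal (hg : IsProfile g) (r : ℝ) (l : Fin (n + 1)) :
    ∀ᵐ y : Fin n → ℝ, (∫ u, g u) * cutoffProd g (r - 1) y ≤
      ∫ u, cutoffProd g r (l.insertNth u y : Fin (n + 1) → ℝ) := by
  filter_upwards [(integrable_comp_insertNth (hg.integrable_cutoffProd r) l).prod_left_ae]
    with y hy
  rw [← integral_mul_const]
  exact integral_mono (hg.integrable.mul_const _) hy fun u =>
    hg.mul_cutoffProd_le_cutoffProd_insertNth r l u y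

theorem mul_integral_cutoffProd_le_marginalEnergy (hg : IsProfile g) (n : ℕ) (r : ℝ) :
    (n + 1) * (∫ u, g u) ^ 2 * ∫ y : Fin n → ℝ, cutoffProd (fun t => g t ^ 2) (r - 1) y ≤
      marginalEnergy (cutoffProd g r : (Fin (n + 1) → ℝ) → ℝ) := by
  have hmarginal : ∀ l : Fin (n + 1),
      (∫ u, g u) ^ 2 * ∫ y : Fin n → ℝ, cutoffProd (fun t => g t ^ 2) (r - 1) y ≤
        ∫ y : Fin n → ℝ, (∫ u, cutoffProd g r (l.insertNth u y : Fin (n + 1) → ℝ)) ^ 2 := by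
    intro l
    rw [← integral_const_mul]
    refine integral_mono_ae ((hg.sq.integrable_cutoffProd _).const_mul _)
      (hg.integrable_marginal_cutoffProd_sq r l) ?_
    filter_upwards [hg.ae_mul_cutoffProd_le_marginal r l] with y hy
    rw [← cutoffProd_sq, ← mul_pow]
    exact pow_le_pow_left₀ (mul_nonneg (integral_nonneg hg.nonneg)
      (cutoffProd_nonneg hg.nonneg)) hy 2
  refine le_trans (le_of_eq ?_) (Finset.sum_le_sum fun l _ => hmarginal l)
  rw [Finset.sum_const, Finset.card_univ, Fintype.card_fin, nsmul_eq_mul]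
  push_cast
  ring

end IsProfile

end MarginalEnergy

/-- The simplex `{x ∈ ℝ^k : 0 ≤ x, ∑ i, x i ≤ a}`; functions of one block of variables are
supported on a simplex of half the size allowed by the region, so that sumsets stay inside it. -/
def solidSimplex (k : ℕ) (a : ℝ) : Set (Fin k → ℝ) := {x | 0 ≤ x ∧ ∑ i, x i ≤ a}

/-- A function of one block of variables which may be used as a tensor factor of an admissible
function: it is continuous on a closed convex subset of the simplex of size `a`, and vanishes off
that subset. Convexity is only there to make the boundary of the support Lebesgue-null. -/
def IsSimplexTest {k : ℕ} (a : ℝ) (F : (Fin k → ℝ) → ℝ) : Prop :=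
  ∃ K ⊆ solidSimplex k a, IsClosed K ∧ Convex ℝ K ∧ ContinuousOn F K ∧ ∀ x ∉ K, F x = 0

section SimplexTest

variable {k : ℕ} {a b : ℝ} {F G : (Fin k → ℝ) → ℝ}

theorem solidSimplex_subset_Icc (k : ℕ) (a : ℝ) :
    solidSimplex k a ⊆ Icc 0 (fun _ => a) :=
  fun _ hx => ⟨hx.1, fun i =>
    (Finset.single_le_sum (fun j _ => hx.1 j) (Finset.mem_univ i)).trans hx.2⟩

theorem solidSimplex_subset_Icc_one (ha : a ≤ 1) : solidSimplex k a ⊆ Icc 0 1 :=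
  (solidSimplex_subset_Icc k a).trans (Icc_subset_Icc_right fun _ => ha)

theorem sum_mem_Icc_of_mem_solidSimplex {x : Fin k → ℝ} (hx : x ∈ solidSimplex k a) :
    ∑ i, x i ∈ Icc 0 a :=
  ⟨Finset.sum_nonneg fun i _ => hx.1 i, hx.2⟩

theorem add_mem_solidSimplex {x y : Fin k → ℝ} (hx : x ∈ solidSimplex k a)
    (hy : y ∈ solidSimplex k a) : x + y ∈ solidSimplex k (2 * a) := by
  refine ⟨add_nonneg hx.1 hy.1, ?_⟩
  simp only [Pi.add_apply, Finset.sum_add_distrib, two_mul]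
  exact add_le_add hx.2 hy.2

theorem cube_eq_prod (k : ℕ) : cube k = Icc (0 : Fin k → ℝ) 1 ×ˢ Icc (0 : Fin k → ℝ) 1 := by
  ext x
  simp only [cube, mem_ofPred_eq, mem_prod, mem_Icc, Pi.le_def, Pi.zero_apply, Pi.one_apply,
    forall_and]

theorem IsProfile.isSimplexTest_cutoffProd {g : ℝ → ℝ} (hg : IsProfile g) (k : ℕ) (r : ℝ) :
    IsSimplexTest r (cutoffProd g r : (Fin k → ℝ) → ℝ) := by
  refine ⟨Icc 0 1 ∩ {x | ∑ i, x i ≤ r}, fun x hx => ⟨hx.1.1, hx.2⟩,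
    isClosed_Icc.inter (isClosed_le (by fun_prop) continuous_const),
    (convex_Icc 0 1).inter (convex_halfSpace_le (IsLinearMap.mk (by simp [Finset.sum_add_distrib])
      (by simp [Finset.mul_sum])) r), ?_, fun x hx => ?_⟩
  · refine (continuousOn_finsetProd Finset.univ fun i _ => hg.continuousOn.comp
      (continuous_apply i).continuousOn fun x hx => ⟨hx.1.1 i, hx.1.2 i⟩).congr fun x hx => ?_
    exact cutoffProd_of_sum_le hx.2
  · rcases le_or_gt (∑ i, x i) r with hr | hr
    · rw [cutoffProd_of_sum_le hr]
      exact by_contra fun h => hx ⟨hg.mem_Icc_of_prod_ne_zero h, hr⟩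
    · exact cutoffProd_of_lt_sum hr

namespace IsSimplexTest

theorem comp_smul {β : ℝ} (hβ : 0 < β) (hF : IsSimplexTest a F) :
    IsSimplexTest (a / β) fun x => F (β • x) := by
  obtain ⟨K, hKa, hKc, hKconv, hFK, hF0⟩ := hF
  refine ⟨(fun x => β • x) ⁻¹' K, fun x hx => ⟨?_, ?_⟩, hKc.preimage (by fun_prop),
    hKconv.smul_preimage β, hFK.comp (by fun_prop) fun x hx => hx, fun x hx => hF0 _ hx⟩
  · exact fun i => (mul_nonneg_iff_of_pos_left hβ).1 ((hKa hx).1 i)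
  · rw [le_div_iff₀' hβ, Finset.mul_sum]
    exact (hKa hx).2

theorem integrable_sq (hF : IsSimplexTest a F) : Integrable fun x => F x ^ 2 := by
  obtain ⟨K, hKa, hKc, -, hFK, hF0⟩ := hF
  have hK : IsCompact K :=
    isCompact_Icc.of_isClosed_subset hKc (hKa.trans (solidSimplex_subset_Icc k a))
  refine (integrableOn_iff_integrable_of_support_subset
    (Function.support_subset_iff'.2 fun x hx => ?_)).1 ((hFK.pow 2).integrableOn_compact hK)
  rw [hF0 x hx, zero_pow two_ne_zero]

theorem eq_zero (hF : IsSimplexTest a F) (ha : a ≤ 1) : ∀ x ∉ Icc 0 1, F x = 0 := by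
  obtain ⟨K, hKa, -, -, -, hF0⟩ := hF
  exact fun x hx => hF0 x fun hxK => hx (solidSimplex_subset_Icc_one ha (hKa hxK))

end IsSimplexTest

theorem isPiecewiseContinuous_of_convex {f : Pt k → ℝ} {Q : Set (Pt k)} (hQ : Convex ℝ Q)
    (hQc : IsClosed Q) (hQs : Q ⊆ cube k) (hf : ContinuousOn f Q) (hf0 : ∀ x ∉ Q, f x = 0) :
    IsPiecewiseContinuous k f := by
  have hcube : Convex ℝ (cube k) := by
    rw [cube_eq_prod]
    exact (convex_Icc 0 1).prod (convex_Icc 0 1)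
  have : (volume : Measure (Pt k)).IsAddHaarMeasure :=
    Measure.prod.instIsAddHaarMeasure (volume : Measure (Fin k → ℝ)) (volume : Measure (Fin k → ℝ))
  refine ⟨2, ![Q, cube k \ Q], ?_, ?_, ?_, ?_⟩
  · refine Eq.trans ?_ (union_sdiff_cancel hQs)
    ext x
    simp only [mem_iUnion, Fin.exists_fin_two, Matrix.cons_val_zero, Matrix.cons_val_one, mem_union]
  · simp only [Fin.forall_fin_two]
    exact ⟨⟨fun h => absurd rfl h, fun _ => disjoint_sdiff_right⟩,
      ⟨fun _ => disjoint_sdiff_left, fun h => absurd rfl h⟩⟩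
  · refine Fin.forall_fin_two.2 ⟨hQ.addHaar_frontier volume, ?_⟩
    refine measure_mono_null (t := frontier (cube k) ∪ frontier Q) ?_
      (measure_union_null (hcube.addHaar_frontier volume) (hQ.addHaar_frontier volume))
    refine (frontier_inter_subset (cube k) Qᶜ).trans (union_subset_union inter_subset_left ?_)
    rw [frontier_compl]
    exact inter_subset_right
  · refine Fin.forall_fin_two.2 ⟨⟨f, ?_, fun _ _ => rfl⟩,
      ⟨fun _ => 0, continuousOn_const, fun x hx => hf0 x hx.2⟩⟩
    rwa [Matrix.cons_val_zero, hQc.closure_eq]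

theorem add_prod_solidSimplex_subset_liftRegion {D : Set (ℝ × ℝ)} (ha : 2 * a ≤ 1) (hb : 2 * b ≤ 1)
    (hD : Icc 0 (2 * a) ×ˢ Icc 0 (2 * b) ⊆ D) :
    solidSimplex k a ×ˢ solidSimplex k b + solidSimplex k a ×ˢ solidSimplex k b ⊆
      liftRegion k D := by
  rintro _ ⟨x, hx, y, hy, rfl⟩
  have h₁ := add_mem_solidSimplex hx.1 hy.1
  have h₂ := add_mem_solidSimplex hx.2 hy.2
  refine ⟨?_, hD ⟨sum_mem_Icc_of_mem_solidSimplex h₁, sum_mem_Icc_of_mem_solidSimplex h₂⟩⟩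
  rw [cube_eq_prod]
  exact ⟨solidSimplex_subset_Icc_one ha h₁, solidSimplex_subset_Icc_one hb h₂⟩

theorem IsSimplexTest.isAdmissible_mul {D : Set (ℝ × ℝ)} (hF : IsSimplexTest a F)
    (hG : IsSimplexTest b G) (ha : 2 * a ≤ 1) (hb : 2 * b ≤ 1)
    (hD : Icc 0 (2 * a) ×ˢ Icc 0 (2 * b) ⊆ D) :
    IsAdmissible k D fun x => F x.1 * G x.2 := by
  obtain ⟨K, hKa, hKc, hKconv, hFK, hF0⟩ := hF
  obtain ⟨L, hLb, hLc, hLconv, hGL, hG0⟩ := hG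
  have hQ : K ×ˢ L ⊆ solidSimplex k a ×ˢ solidSimplex k b := prod_mono hKa hLb
  have hQcube : K ×ˢ L ⊆ cube k := by
    rw [cube_eq_prod]
    exact hQ.trans (prod_mono (solidSimplex_subset_Icc_one (by linarith))
      (solidSimplex_subset_Icc_one (by linarith)))
  have hvanish : ∀ x ∉ K ×ˢ L, F x.1 * G x.2 = 0 := by
    intro x hx
    by_cases hx₁ : x.1 ∈ K
    · rw [hG0 x.2 fun hx₂ => hx ⟨hx₁, hx₂⟩, mul_zero]
    · rw [hF0 x.1 hx₁, zero_mul]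
  refine ⟨isPiecewiseContinuous_of_convex (hKconv.prod hLconv) (hKc.prod hLc) hQcube ?_ hvanish,
    K ×ˢ L, hKc.prod hLc, hQcube, (add_subset_add hQ hQ).trans
      (add_prod_solidSimplex_subset_liftRegion ha hb hD), fun x hx => not_imp_comm.1 (hvanish x) hx⟩
  exact (hFK.comp continuousOn_fst fun x hx => hx.1).mul
    (hGL.comp continuousOn_snd fun x hx => hx.2)

end SimplexTest

section Factorization

variable {k n : ℕ}

theorem IInt_mul {F G : (Fin k → ℝ) → ℝ} (hF : ∀ x ∉ Icc 0 1, F x = 0)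
    (hG : ∀ x ∉ Icc 0 1, G x = 0) :
    IInt k (fun x => F x.1 * G x.2) = (∫ x, F x ^ 2) * ∫ x, G x ^ 2 := by
  simp_rw [IInt, cube_eq_prod, mul_pow]
  rw [Measure.volume_eq_prod, setIntegral_prod_mul (fun x => F x ^ 2) fun x => G x ^ 2,
    setIntegral_eq_integral_of_forall_compl_eq_zero fun x hx => by simp [hF x hx],
    setIntegral_eq_integral_of_forall_compl_eq_zero fun x hx => by simp [hG x hx]]

theorem JInt_mul (F G : (Fin k → ℝ) → ℝ) (l l' : Fin k) :
    JInt k l l' (fun x => F x.1 * G x.2) =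
      (∫ x in Icc 0 1, (∫ u in (0 : ℝ)..1, F (Function.update x l u)) ^ 2) *
        ∫ x in Icc 0 1, (∫ u in (0 : ℝ)..1, G (Function.update x l' u)) ^ 2 := by
  simp_rw [JInt, intervalIntegral.integral_mul_const, intervalIntegral.integral_const_mul,
    mul_pow, cube_eq_prod]
  rw [Measure.volume_eq_prod,
    setIntegral_prod_mul (fun x => (∫ u in (0 : ℝ)..1, F (Function.update x l u)) ^ 2)
      fun x => (∫ u in (0 : ℝ)..1, G (Function.update x l' u)) ^ 2]

theorem intervalIntegral_comp_insertNth {F : (Fin (n + 1) → ℝ) → ℝ}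
    (hF : ∀ x ∉ Icc 0 1, F x = 0) (l : Fin (n + 1)) (y : Fin n → ℝ) :
    ∫ u in (0 : ℝ)..1, F (l.insertNth u y) = ∫ u, F (l.insertNth u y) := by
  rw [intervalIntegral.integral_of_le zero_le_one, ← integral_Icc_eq_integral_Ioc]
  exact setIntegral_eq_integral_of_forall_compl_eq_zero fun u hu =>
    hF _ fun h => hu (Fin.insertNth_mem_Icc.1 h).1

theorem setIntegral_intervalIntegral_update_sq {F : (Fin (n + 1) → ℝ) → ℝ}
    (hF : ∀ x ∉ Icc 0 1, F x = 0) (l : Fin (n + 1)) :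
    ∫ x in Icc 0 1, (∫ u in (0 : ℝ)..1, F (Function.update x l u)) ^ 2 =
      ∫ y : Fin n → ℝ, (∫ u, F (l.insertNth u y)) ^ 2 := by
  have hbox : (fun p : ℝ × (Fin n → ℝ) => (l.insertNth p.1 p.2 : Fin (n + 1) → ℝ)) ⁻¹' Icc 0 1 =
      Icc (0 : ℝ) 1 ×ˢ Icc (0 : Fin n → ℝ) 1 := by
    ext p
    exact Fin.insertNth_mem_Icc
  have hfactor := setIntegral_prod_mul (μ := (volume : Measure ℝ)) (ν := volume) (fun _ => (1 : ℝ))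
    (fun y : Fin n → ℝ => (∫ u, F (l.insertNth u y)) ^ 2) (Icc 0 1) (Icc 0 1)
  rw [← (measurePreserving_insertNth l).setIntegral_preimage_emb
    (measurableEmbedding_insertNth l), hbox]
  simp_rw [Fin.update_insertNth, intervalIntegral_comp_insertNth hF]
  simp only [one_mul] at hfactor
  rw [Measure.volume_eq_prod, hfactor, setIntegral_const, Real.volume_real_Icc_of_le zero_le_one,
    sub_zero, one_smul, one_mul]
  refine setIntegral_eq_integral_of_forall_compl_eq_zero fun y hy => ?_
  simp [hF _ fun h => hy (Fin.insertNth_mem_Icc.1 h).2]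

theorem sum_JInt_mul {F G : (Fin (n + 1) → ℝ) → ℝ} (hF : ∀ x ∉ Icc 0 1, F x = 0)
    (hG : ∀ x ∉ Icc 0 1, G x = 0) :
    ∑ l, ∑ l', JInt (n + 1) l l' (fun x => F x.1 * G x.2) =
      marginalEnergy F * marginalEnergy G := by
  simp_rw [JInt_mul, setIntegral_intervalIntegral_update_sq hF,
    setIntegral_intervalIntegral_update_sq hG, marginalEnergy, Finset.sum_mul_sum]

theorem mul_lt_MSq {a b p q : ℝ} {D : Set (ℝ × ℝ)} {F G : (Fin (n + 1) → ℝ) → ℝ}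
    (hF : IsSimplexTest a F) (hG : IsSimplexTest b G) (ha : 2 * a ≤ 1) (hb : 2 * b ≤ 1)
    (hD : Icc 0 (2 * a) ×ˢ Icc 0 (2 * b) ⊆ D) (hp : 0 ≤ p) (hq : 0 ≤ q)
    (hpF : p * ∫ x, F x ^ 2 < marginalEnergy F) (hqG : q * ∫ x, G x ^ 2 < marginalEnergy G) :
    ((p * q : ℝ) : EReal) < MSq (n + 1) D := by
  have hF0 := hF.eq_zero (by linarith)
  have hG0 := hG.eq_zero (by linarith)
  have hFnn : 0 ≤ ∫ x, F x ^ 2 := integral_nonneg fun x => sq_nonneg _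
  have hGnn : 0 ≤ ∫ x, G x ^ 2 := integral_nonneg fun x => sq_nonneg _
  have hFpos := integral_sq_pos_of_marginalEnergy_pos hF.integrable_sq
    ((mul_nonneg hp hFnn).trans_lt hpF)
  have hGpos := integral_sq_pos_of_marginalEnergy_pos hG.integrable_sq
    ((mul_nonneg hq hGnn).trans_lt hqG)
  refine lt_of_lt_of_le ?_ (le_sSup ⟨fun x => F x.1 * G x.2, hF.isAdmissible_mul hG ha hb hD,
    by rw [IInt_mul hF0 hG0]; positivity, rfl⟩)
  rw [EReal.coe_lt_coe_iff, sum_JInt_mul hF0 hG0, IInt_mul hF0 hG0, lt_div_iff₀ (by positivity),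
    mul_mul_mul_comm]
  exact mul_lt_mul'' hpF hqG (by positivity) (by positivity)

end Factorization

/-- The profile `1 / (1 + A t)` on `[0, 1]`, from which Maynard builds test functions with a large
quotient when the number of variables is large. -/
noncomputable def reciprocalProfile (A : ℝ) : ℝ → ℝ :=
  (Icc 0 1).indicator fun t => (1 + A * t)⁻¹

section ReciprocalProfile

variable {A c : ℝ} {t : ℝ}

theorem reciprocalProfile_of_mem (ht : t ∈ Icc (0 : ℝ) 1) :
    reciprocalProfile A t = (1 + A * t)⁻¹ :=
  indicator_of_mem ht _

theorem one_add_mul_pos (hA : 0 ≤ A) (ht : t ∈ Icc (0 : ℝ) 1) : 0 < 1 + A * t :=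
  add_pos_of_pos_of_nonneg one_pos (mul_nonneg hA ht.1)

theorem isProfile_reciprocalProfile (hA : 0 ≤ A) : IsProfile (reciprocalProfile A) where
  nonneg := indicator_nonneg fun _ ht => (inv_pos.2 (one_add_mul_pos hA ht)).le
  continuousOn := ContinuousOn.congr
    (ContinuousOn.inv₀ (by fun_prop) fun _ ht => (one_add_mul_pos hA ht).ne')
    fun _ ht => reciprocalProfile_of_mem ht
  eq_zero _ ht := indicator_of_notMem ht _

theorem integral_reciprocalProfile (hA : 0 < A) :
    ∫ t, reciprocalProfile A t = Real.log (1 + A) / A := by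
  have hderiv : ∀ t ∈ uIcc (0 : ℝ) 1,
      HasDerivAt (fun t => Real.log (1 + A * t) / A) (1 + A * t)⁻¹ t := by
    intro t ht
    rw [uIcc_of_le zero_le_one] at ht
    have hlin : HasDerivAt (fun t => 1 + A * t) A t := by
      simpa using ((hasDerivAt_id t).const_mul A).const_add 1
    refine ((hlin.log (one_add_mul_pos hA.le ht).ne').div_const A).congr_deriv ?_
    rw [div_right_comm, div_self hA.ne', one_div]
  have hcont : ContinuousOn (fun t => (1 + A * t)⁻¹) (uIcc (0 : ℝ) 1) := by
    rw [uIcc_of_le zero_le_one]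
    exact ContinuousOn.inv₀ (by fun_prop) fun _ ht => (one_add_mul_pos hA.le ht).ne'
  rw [(isProfile_reciprocalProfile hA.le).integral_eq_intervalIntegral,
    intervalIntegral.integral_congr (g := fun t => (1 + A * t)⁻¹) fun t ht =>
      reciprocalProfile_of_mem (by rwa [uIcc_of_le zero_le_one] at ht),
    intervalIntegral.integral_eq_sub_of_hasDerivAt hderiv hcont.intervalIntegrable]
  simp

theorem add_inv_mul_reciprocalProfile_sq (hA : 0 < A) (t : ℝ) :
    (t + A⁻¹) * reciprocalProfile A t ^ 2 = A⁻¹ * reciprocalProfile A t := by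
  by_cases ht : t ∈ Icc (0 : ℝ) 1
  · have hpos := one_add_mul_pos hA.le ht
    have hfactor : t + A⁻¹ = A⁻¹ * (1 + A * t) := by rw [mul_add, inv_mul_cancel_left₀ hA.ne']; ring
    rw [reciprocalProfile_of_mem ht, hfactor, sq, mul_assoc, mul_inv_cancel_left₀ hpos.ne']
  · rw [(isProfile_reciprocalProfile hA.le).eq_zero t ht]
    ring

theorem integral_add_inv_mul_exp_mul_reciprocalProfile_sq_le (hA : 0 < A) (hc : 0 ≤ c) :
    ∫ t, (t + A⁻¹) * (Real.exp (-c * t) * reciprocalProfile A t ^ 2) ≤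
      A⁻¹ * (Real.log (1 + A) / A) := by
  have hg := isProfile_reciprocalProfile hA.le
  rw [← integral_reciprocalProfile hA, ← integral_const_mul]
  have hrewrite : ∀ t, (t + A⁻¹) * (Real.exp (-c * t) * reciprocalProfile A t ^ 2) =
      A⁻¹ * (Real.exp (-c * t) * reciprocalProfile A t) := fun t => by
    rw [mul_left_comm, add_inv_mul_reciprocalProfile_sq hA, mul_left_comm]
  simp_rw [hrewrite]
  refine integral_mono ((hg.exp_neg_mul c).integrable.const_mul _) (hg.integrable.const_mul _)
    fun t => mul_le_mul_of_nonneg_left ?_ (inv_nonneg.2 hA.le)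
  by_cases ht : t ∈ Icc (0 : ℝ) 1
  · exact mul_le_of_le_one_left (hg.nonneg t) (Real.exp_le_one_iff.2 (by nlinarith [ht.1]))
  · rw [hg.eq_zero t ht, mul_zero]

theorem exists_mul_integral_sq_lt_marginalEnergy_cutoffProd {C : ℝ} {n : ℕ} (hc : 0 < c)
    (hC0 : 0 ≤ C) (hC : C < Real.log (1 + c * (n + 1)) * Real.exp (-c)) :
    ∃ g, IsProfile g ∧ ∃ r > 0, C * (r * ∫ x : Fin (n + 1) → ℝ, cutoffProd g r x ^ 2) <
      marginalEnergy (cutoffProd g r : (Fin (n + 1) → ℝ) → ℝ) := by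
  set A := c * (n + 1)
  have hA : 0 < A := by positivity
  set γ := Real.log (1 + A) / A with hγ
  have hlog : 0 < Real.log (1 + A) := Real.log_pos (by linarith)
  have hg := isProfile_reciprocalProfile hA.le
  have hmass : 0 < ∫ t, Real.exp (-c * t) * reciprocalProfile A t ^ 2 :=
    (hg.sq.exp_neg_mul c).integral_pos fun t ht => by
      have ht' := Ioo_subset_Icc_self ht
      have := one_add_mul_pos hA.le ht'
      rw [reciprocalProfile_of_mem ht']
      positivity
  obtain ⟨r, hr, hlt⟩ := exists_mul_integral_cutoffProd_lt (C := C) (b := (n + 1) * γ ^ 2) hg.sq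
    (by positivity) hc n hmass <| calc
      C * ((n + 1) * ∫ t, (t + A⁻¹) * (Real.exp (-c * t) * reciprocalProfile A t ^ 2))
        ≤ C * ((n + 1) * (A⁻¹ * γ)) := by
          gcongr
          exact integral_add_inv_mul_exp_mul_reciprocalProfile_sq_le hA hc.le
      _ < Real.log (1 + A) * Real.exp (-c) * ((n + 1) * (A⁻¹ * γ)) := by gcongr
      _ = (n + 1) * γ ^ 2 * Real.exp (-c) := by rw [hγ]; ring
  refine ⟨_, hg, r, hr, ?_⟩
  simp_rw [cutoffProd_sq]
  refine hlt.trans_le ?_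
  rw [hγ, ← integral_reciprocalProfile hA]
  exact hg.mul_integral_cutoffProd_le_marginalEnergy n r

theorem exists_isSimplexTest_mul_lt_marginalEnergy {a C : ℝ} {n : ℕ} (hc : 0 < c) (hC0 : 0 ≤ C)
    (hC : C < Real.log (1 + c * (n + 1)) * Real.exp (-c)) (ha : 0 < a) :
    ∃ F : (Fin (n + 1) → ℝ) → ℝ, IsSimplexTest a F ∧
      C * a * ∫ x, F x ^ 2 < marginalEnergy F := by
  obtain ⟨g, hg, r, hr, hlt⟩ := exists_mul_integral_sq_lt_marginalEnergy_cutoffProd hc hC0 hC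
  have hβ : 0 < r / a := div_pos hr ha
  refine ⟨fun x => cutoffProd g r ((r / a) • x), ?_, ?_⟩
  · simpa only [div_div_cancel₀ hr.ne'] using
      (hg.isSimplexTest_cutoffProd (n + 1) r).comp_smul hβ
  · rw [integral_comp_smul_sq _ hβ, marginalEnergy_comp_smul _ hβ]
    refine lt_of_eq_of_lt ?_ (mul_lt_mul_of_pos_left hlt (inv_pos.2 (pow_pos hβ (n + 2))))
    rw [pow_succ _ (n + 1), mul_inv, inv_div]
    field_simp

end ReciprocalProfile

-- `0.17` nearly maximises `c ↦ log (1 + 2000 c) * exp (-c)`, and `4.9` just exceeds `√24`.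
theorem lt_log_mul_exp_neg : (4.9 : ℝ) < Real.log (1 + 0.17 * 2000) * Real.exp (-0.17) := by
  have hlog : (5.822 : ℝ) ≤ Real.log (1 + 0.17 * 2000) := by
    have hpow := Real.log_le_log (x := 2 ^ 42) (y := (1 + 0.17 * 2000 : ℝ) ^ 5) (by norm_num)
      (by norm_num)
    rw [Real.log_pow, Real.log_pow, Nat.cast_ofNat, Nat.cast_ofNat] at hpow
    linarith [Real.log_two_gt_d9]
  have hexp : (0.99 : ℝ) ^ 17 ≤ Real.exp (-0.17) := calc
    (0.99 : ℝ) ^ 17 ≤ Real.exp (-0.01) ^ 17 := by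
      gcongr
      linarith [Real.one_sub_le_exp_neg 0.01]
    _ = Real.exp (-0.17) := by rw [← Real.exp_nat_mul]; norm_num
  calc (4.9 : ℝ) < 5.822 * 0.99 ^ 17 := by norm_num
    _ ≤ _ := by gcongr

theorem mainTheorem9_general {k : ℕ} (hk : 2000 ≤ k) : 1 < MSq k regionD := by
  obtain ⟨n, rfl⟩ := Nat.exists_eq_add_of_le' (by lia : 1 ≤ k)
  have hn : (2000 : ℝ) ≤ n + 1 := by exact_mod_cast hk
  have hC : (4.9 : ℝ) < Real.log (1 + 0.17 * (n + 1)) * Real.exp (-0.17) :=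
    lt_log_mul_exp_neg.trans_le (by gcongr)
  obtain ⟨F, hF, hFlt⟩ := exists_isSimplexTest_mul_lt_marginalEnergy (a := 1 / 4) (by norm_num)
    (by norm_num) hC (by norm_num)
  obtain ⟨G, hG, hGlt⟩ := exists_isSimplexTest_mul_lt_marginalEnergy (a := 1 / 6) (by norm_num)
    (by norm_num) hC (by norm_num)
  have hD : Icc (0 : ℝ) (2 * (1 / 4)) ×ˢ Icc (0 : ℝ) (2 * (1 / 6)) ⊆ regionD := by
    norm_num [regionD, subset_union_left]
  refine lt_trans ?_ (mul_lt_MSq hF hG (by norm_num) (by norm_num) hD (by norm_num) (by norm_num)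
    hFlt hGlt)
  exact_mod_cast (by norm_num : (1 : ℝ) < 4.9 * (1 / 4) * (4.9 * (1 / 6)))

theorem mainTheorem9 : 1 < MSq 2000 regionD :=
  mainTheorem9_general le_rfl
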